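/- Let $d\ge 1$ be an integer, let $\mathbb{B}^d$ be the open unit ball of $\mathbb{C}^d$, and for $\lambda>d$ let $\mu_\lambda$ be the probability measure on $\mathbb{B}^d$ given by $$d\mu_\lambda(z)=c_\lambda\,(1-|z|^2)^{\lambda}\,d\tau(z),\qquad d\tau(z)=(1-|z|^2)^{-(d+1)}\,dz,\qquad c_\lambda=\frac{\Gamma(\lambda)}{\pi^d\,\Gamma(\lambda-d)},$$ where $dz$ is $2d$-dimensional Lebesgue measure. Let $\mathcal{H}L^2(\mathbb{B}^d,\mu_\lambda)$ be the space of holomorphic functions on $\mathbb{B}^d$ that are square-integrable with respect to $\mu_\lambda$, with inner product $\langle f,g\rangle_{\mathcal{H}L^2(\mathbb{B}^d,\mu_\lambda)}=\int_{\mathbb{B}^d}\overline{f}\,g\,d\mu_\lambda$, and let $N=\sum_{j=1}^d z_j\,\partial/\partial z_j$. Fix $\lambda>d$ and an integer $n\ge 0$. Then a holomorphic function $f$ on $\mathbb{B}^d$ belongs to $\mathcal{H}L^2(\mathbb{B}^d,\mu_\lambda)$ if and only if $N^l f$ belongs to $\mathcal{H}L^2(\mathbb{B}^d,\mu_{\lambda+2n})$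 for all $0\le l\le n$. Furthermore, for all $f,g\in\mathcal{H}L^2(\mathbb{B}^d,\mu_\lambda)$, the functions $Af$ and $Bg$ belong to $\mathcal{H}L^2(\mathbb{B}^d,\mu_{\lambda+2n})$ and $$\langle f,g\rangle_{\mathcal{H}L^2(\mathbb{B}^d,\mu_\lambda)}=\langle Af,Bg\rangle_{\mathcal{H}L^2(\mathbb{B}^d,\mu_{\lambda+2n})},$$ where $$A=\Bigl(I+\frac{N}{\lambda+n}\Bigr)\Bigl(I+\frac{N}{\lambda+n+1}\Bigr)\cdots\Bigl(I+\frac{N}{\lambda+2n-1}\Bigr),\qquad B=\Bigl(I+\frac{N}{\lambda}\Bigr)\Bigl(I+\frac{N}{\lambda+1}\Bigr)\cdots\Bigl(I+\frac{N}{\lambda+n-1}\Bigr)$$ (for $n=0$ both are the identity). -/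

import Mathlib

open MeasureTheory

noncomputable section

namespace Bergman

/-- The space `ℂ^d` with its Euclidean norm `|z|`; its `volume` is `2d`-dimensional Lebesgue
measure `dz`. -/
abbrev Cd (d : ℕ) : Type := EuclideanSpace ℂ (Fin d)

/-- The open unit ball of `ℂ^d`. -/
def unitBall (d : ℕ) : Set (Cd d) := Metric.ball 0 1

/-- The hyperbolic volume measure `(1 - |z|²)^{-(d+1)} dz` on the unit ball (extended by `0` outside
the ball). -/
def tau (d : ℕ) : Measure (Cd d) :=
  ((volume : Measure (Cd d)).restrict (unitBall d)).withDensity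
    fun z => ENNReal.ofReal ((1 - ‖z‖ ^ 2) ^ (-((d : ℝ) + 1)))

/-- The constant `c_λ = Γ(λ) / (π^d Γ(λ - d))`, for `λ > d`. -/
def normConst (d : ℕ) (lam : ℝ) : ℝ :=
  Real.Gamma lam / (Real.pi ^ d * Real.Gamma (lam - d))

/-- The measure `dμ_λ(z) = c_λ (1 - |z|²)^λ dτ(z)`. -/
def mu (d : ℕ) (lam : ℝ) : Measure (Cd d) :=
  (tau d).withDensity fun z => ENNReal.ofReal (normConst d lam * (1 - ‖z‖ ^ 2) ^ lam)

/-- `f` is holomorphic on the unit ball. Functions on the ball are represented by functions on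
`ℂ^d` whose values outside the ball are irrelevant. -/
def HolomorphicOnBall (d : ℕ) (f : Cd d → ℂ) : Prop :=
  DifferentiableOn ℂ f (unitBall d)

/-- `f` belongs to the weighted Bergman space `HL²(B^d, μ_λ)`. -/
def MemHL2 (d : ℕ) (lam : ℝ) (f : Cd d → ℂ) : Prop :=
  HolomorphicOnBall d f ∧ MemLp f 2 (mu d lam)

/-- The `L²` inner product `⟨f, g⟩ = ∫ conj(f) g dμ_λ`, conjugate-linear in the first variable. -/
def innerHL2 (d : ℕ) (lam : ℝ) (f g : Cd d → ℂ) : ℂ :=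
  ∫ z, starRingEnd ℂ (f z) * g z ∂(mu d lam)

/-- The number operator `N = ∑ j, z_j ∂/∂z_j`. -/
def numberOp (d : ℕ) (f : Cd d → ℂ) : Cd d → ℂ :=
  fun z => ∑ j : Fin d, z j * fderiv ℂ f z (EuclideanSpace.single j 1)

/-- The operator `I + N / s`. -/
def shiftFactor (d : ℕ) (s : ℝ) (f : Cd d → ℂ) : Cd d → ℂ :=
  fun z => f z + numberOp d f z / (s : ℂ)

/-- The product of operators `(I + N/s) (I + N/(s+1)) ⋯ (I + N/(s+k-1))`, with `k` factors. -/
def shiftProd (d : ℕ) (s : ℝ) : ℕ → (Cd d → ℂ) → (Cd d → ℂ)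
  | 0 => id
  | k + 1 => shiftProd d s k ∘ shiftFactor d (s + k)

/-- `A = (I + N/(λ+n)) (I + N/(λ+n+1)) ⋯ (I + N/(λ+2n-1))`. -/
def opA (d : ℕ) (lam : ℝ) (n : ℕ) : (Cd d → ℂ) → (Cd d → ℂ) := shiftProd d (lam + n) n

/-- `B = (I + N/λ) (I + N/(λ+1)) ⋯ (I + N/(λ+n-1))`. -/
def opB (d : ℕ) (lam : ℝ) (n : ℕ) : (Cd d → ℂ) → (Cd d → ℂ) := shiftProd d lam n

end Bergman

end

namespace Bergman

open Metric Set Filter Topology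

/-! Decompose `f` into homogeneous components `f_k`, the Taylor coefficients of the slices `t ↦ f (t
• z)`. Since `μ_λ` is rotation invariant, Parseval on circles gives `‖f‖²_λ = ∑ ‖f_k‖²_λ` in `[0,
∞]` (`lintegral_enorm_sq_eq_tsum`). In polar coordinates only the radial factor of `‖f_k‖²_λ`
depends on `λ`, and a Beta-type recursion gives `‖f_k‖²_λ = (1 + k/λ) ‖f_k‖²_{λ+1}`
(`lintegral_mu_succ`). Iterating `2n` times produces the factor `E_k = ∏_{j<2n} (1 + k/(λ+j))`.

As `N f_k = k f_k`, the operators `B` and `A` multiply `f_k` by the first `n` and the last `n`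
factors of `E_k`. Hence the two inner products agree degree by degree. Membership follows because
`E_k` is comparable to `(1 + k)^(2n)`, the square of the growth allowed by `n` applications of `N`.
-/

/-! ### Homogeneous components and the Euler operator on slices. -/

/-- The degree `k` homogeneous component of `f` at the origin. -/
noncomputable def homogComp {d : ℕ} (k : ℕ) (f : Cd d → ℂ) (z : Cd d) : ℂ :=
  (k.factorial : ℂ)⁻¹ * iteratedDeriv k (fun t : ℂ => f (t • z)) 0

lemma differentiableOn_slice {d : ℕ} {f : Cd d → ℂ} (hf : HolomorphicOnBall d f) {z : Cd d}
    {R : ℝ} (hR : R * ‖z‖ ≤ 1) : DifferentiableOn ℂ (fun t : ℂ => f (t • z)) (ball 0 R) := by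
  refine DifferentiableOn.comp (t := unitBall d) hf (by fun_prop) fun t ht => ?_
  rw [mem_ball_zero_iff] at ht
  rw [unitBall, mem_ball_zero_iff, norm_smul]
  rcases (norm_nonneg z).eq_or_lt with h | h
  · simp [← h]
  · exact (mul_lt_mul_of_pos_right ht h).trans_le hR

/-- Here `z` need not lie in the ball: components are defined, and homogeneous, on the whole space,
as the polar coordinate argument requires. -/
lemma exists_radius {d : ℕ} (z : Cd d) : ∃ R : ℝ, 0 < R ∧ R * ‖z‖ ≤ 1 := by
  refine ⟨(1 + ‖z‖)⁻¹, by positivity, ?_⟩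
  rw [inv_mul_le_iff₀ (by positivity)]
  linarith

lemma exists_radius_gt_one {d : ℕ} {z : Cd d} (hz : z ∈ unitBall d) :
    ∃ R : ℝ, 1 < R ∧ R * ‖z‖ ≤ 1 := by
  rw [unitBall, mem_ball_zero_iff] at hz
  have := norm_nonneg z
  refine ⟨2 / (1 + ‖z‖), ?_, ?_⟩
  · rw [lt_div_iff₀ (by positivity)]; linarith
  · rw [div_mul_eq_mul_div, div_le_iff₀ (by positivity)]; linarith

lemma contDiffAt_slice {d : ℕ} {f : Cd d → ℂ} (hf : HolomorphicOnBall d f) (z : Cd d)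
    {n : WithTop ℕ∞} : ContDiffAt ℂ n (fun t : ℂ => f (t • z)) 0 := by
  obtain ⟨R, hR, h⟩ := exists_radius z
  exact ((differentiableOn_slice hf h).analyticAt (ball_mem_nhds 0 hR)).contDiffAt

lemma iteratedDeriv_comp_mul_left_eq (g : ℂ → ℂ) (c : ℂ) (k : ℕ) :
    iteratedDeriv k (fun t => g (c * t)) = fun t => c ^ k * iteratedDeriv k g (c * t) := by
  induction k with
  | zero => simp
  | succ k ih =>
    rw [iteratedDeriv_succ, ih]
    funext t
    rw [deriv_const_mul_field, deriv_comp_mul_left c (iteratedDeriv k g), iteratedDeriv_succ,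
      smul_eq_mul]
    ring

lemma homogComp_smul {d : ℕ} (k : ℕ) (f : Cd d → ℂ) (c : ℂ) (z : Cd d) :
    homogComp k f (c • z) = c ^ k * homogComp k f z := by
  have h : (fun t : ℂ => f (t • c • z)) = fun t => (fun s : ℂ => f (s • z)) (c * t) := by
    funext t; simp only [smul_smul, mul_comm]
  rw [homogComp, h, iteratedDeriv_comp_mul_left_eq (fun s : ℂ => f (s • z)), homogComp]
  simp only [mul_zero]
  ring

lemma hasSum_homogComp {d : ℕ} {f : Cd d → ℂ} (hf : HolomorphicOnBall d f) {z : Cd d} {R : ℝ}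
    (hR : R * ‖z‖ ≤ 1) {t : ℂ} (ht : ‖t‖ < R) :
    HasSum (fun k => homogComp k f z * t ^ k) (f (t • z)) := by
  have := Complex.hasSum_taylorSeries_on_ball (differentiableOn_slice hf hR)
    (mem_ball_zero_iff.2 ht)
  refine this.congr_fun fun k => ?_
  simp only [homogComp, sub_zero, smul_eq_mul]
  ring

lemma homogComp_add_const_mul {d : ℕ} {f g : Cd d → ℂ} (hf : HolomorphicOnBall d f)
    (hg : HolomorphicOnBall d g) (c : ℂ) (k : ℕ) (z : Cd d) :
    homogComp k (fun w => f w + c * g w) z = homogComp k f z + c * homogComp k g z := by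
  have h := iteratedDeriv_add (n := k) (contDiffAt_slice hf z)
    (ContDiffAt.mul contDiffAt_const (contDiffAt_slice hg z) (f := fun _ => c))
  simp only [homogComp]
  erw [h, iteratedDeriv_const_mul_field]
  ring

lemma numberOp_eq {d : ℕ} (f : Cd d → ℂ) (z : Cd d) : numberOp d f z = fderiv ℂ f z z := by
  conv_rhs => enter [2]; rw [← (EuclideanSpace.basisFun (Fin d) ℂ).sum_repr z]
  simp [numberOp]

lemma numberOp_smul {d : ℕ} {f : Cd d → ℂ} {t : ℂ} {z : Cd d}
    (hf : DifferentiableAt ℂ f (t • z)) :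
    numberOp d f (t • z) = t * deriv (fun s : ℂ => f (s • z)) t := by
  have h1 : HasDerivAt (fun s : ℂ => s • z) z t := by
    simpa using (hasDerivAt_id t).smul_const z
  have h2 : HasDerivAt (fun s : ℂ => f (s • z)) (fderiv ℂ f (t • z) z) t :=
    hf.hasFDerivAt.comp_hasDerivAt t h1
  rw [numberOp_eq, h2.deriv]
  simp

lemma HolomorphicOnBall.differentiableAt {d : ℕ} {f : Cd d → ℂ} (hf : HolomorphicOnBall d f)
    {z : Cd d} (hz : z ∈ unitBall d) : DifferentiableAt ℂ f z :=
  DifferentiableOn.differentiableAt hf (isOpen_ball.mem_nhds hz)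

/-- In the Leibniz sum at `0` only the term differentiating the factor `t` exactly once survives. -/
lemma iteratedDeriv_mul_deriv {g : ℂ → ℂ} (hg : AnalyticAt ℂ g 0) (k : ℕ) :
    iteratedDeriv k (fun t => t * deriv g t) 0 = k * iteratedDeriv k g 0 := by
  have h := iteratedDeriv_mul (n := k) (x := (0 : ℂ)) (f := fun t : ℂ => t) contDiffAt_id
    hg.deriv.contDiffAt
  erw [h]
  cases k with
  | zero => simp
  | succ k =>
    rw [Finset.sum_eq_single 1]
    · simp [iteratedDeriv_fun_id_zero, iteratedDeriv_succ']
    · intro i _ hi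
      simp [iteratedDeriv_fun_id_zero, hi]
    · simp

lemma homogComp_numberOp {d : ℕ} {f : Cd d → ℂ} (hf : HolomorphicOnBall d f) (k : ℕ) (z : Cd d) :
    homogComp k (numberOp d f) z = k * homogComp k f z := by
  obtain ⟨R, hR, h⟩ := exists_radius z
  have hev : (fun t : ℂ => numberOp d f (t • z)) =ᶠ[𝓝 0]
      fun t => t * deriv (fun s : ℂ => f (s • z)) t := by
    have hc : ContinuousAt (fun t : ℂ => t • z) 0 := by fun_prop
    have : unitBall d ∈ 𝓝 ((0 : ℂ) • z) := isOpen_ball.mem_nhds (by simp)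
    filter_upwards [hc this] with t ht
    exact numberOp_smul (hf.differentiableAt ht)
  rw [homogComp, hev.iteratedDeriv_eq, iteratedDeriv_mul_deriv
    ((differentiableOn_slice hf h).analyticAt (ball_mem_nhds 0 hR)), homogComp]
  ring

/-! ### Cauchy's formula and Parseval on circles. -/

lemma circleMap_zero_one_smul_mem {d : ℕ} {z : Cd d} (hz : z ∈ unitBall d) (θ : ℝ) :
    circleMap 0 1 θ • z ∈ unitBall d := by
  simpa [unitBall, norm_smul] using hz

lemma homogComp_eq_integral {d : ℕ} {f : Cd d → ℂ} (hf : HolomorphicOnBall d f) {z : Cd d}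
    (hz : z ∈ unitBall d) (k : ℕ) :
    homogComp k f z = (2 * Real.pi : ℂ)⁻¹ *
      ∫ θ in (0 : ℝ)..2 * Real.pi, (circleMap 0 1 θ ^ k)⁻¹ * f (circleMap 0 1 θ • z) := by
  obtain ⟨R, hR, h⟩ := exists_radius_gt_one hz
  have := ((differentiableOn_slice hf h).mono
    (closedBall_subset_ball hR)).circleIntegral_one_div_sub_center_pow_smul one_pos k
  have h2 : ∀ θ : ℝ, deriv (circleMap 0 1) θ • (1 / (circleMap 0 1 θ - 0) ^ (k + 1)) •
      f (circleMap 0 1 θ • z) =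
      Complex.I * ((circleMap 0 1 θ ^ k)⁻¹ * f (circleMap 0 1 θ • z)) := by
    intro θ
    have : circleMap 0 1 θ ≠ 0 := circleMap_ne_center one_ne_zero
    rw [deriv_circleMap]
    simp only [smul_eq_mul, sub_zero]
    field_simp
    ring
  rw [circleIntegral] at this
  simp_rw [h2] at this
  rw [intervalIntegral.integral_const_mul] at this
  have hpi : (Real.pi : ℂ) ≠ 0 := by exact_mod_cast Real.pi_ne_zero
  have hk : (k.factorial : ℂ) ≠ 0 := by exact_mod_cast k.factorial_ne_zero
  have h3 := mul_left_cancel₀ Complex.I_ne_zero (this.trans (b := _) (c := Complex.I *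
    ((2 * Real.pi / k.factorial) * iteratedDeriv k (fun t : ℂ => f (t • z)) 0))
    (by rw [smul_eq_mul]; ring))
  rw [h3, homogComp]
  field_simp

lemma summable_norm_homogComp {d : ℕ} {f : Cd d → ℂ} (hf : HolomorphicOnBall d f) {z : Cd d}
    (hz : z ∈ unitBall d) : Summable fun k => ‖homogComp k f z‖ := by
  obtain ⟨R, hR, h⟩ := exists_radius_gt_one hz
  have := (hasSum_homogComp hf h (t := 1) (by simpa using hR)).summable.norm
  simpa using this

lemma continuous_slice_circle {d : ℕ} {f : Cd d → ℂ} (hf : HolomorphicOnBall d f) {z : Cd d}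
    (hz : z ∈ unitBall d) : Continuous fun θ : ℝ => f (circleMap 0 1 θ • z) :=
  hf.continuousOn.comp_continuous (by fun_prop) (circleMap_zero_one_smul_mem hz)

/-- Parseval's identity on the circle through `z`. -/
lemma hasSum_norm_sq_homogComp {d : ℕ} {f : Cd d → ℂ} (hf : HolomorphicOnBall d f) {z : Cd d}
    (hz : z ∈ unitBall d) :
    HasSum (fun k => 2 * Real.pi * ‖homogComp k f z‖ ^ 2)
      (∫ θ in (0 : ℝ)..2 * Real.pi, ‖f (circleMap 0 1 θ • z)‖ ^ 2) := by
  obtain ⟨R, hR, h⟩ := exists_radius_gt_one hz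
  have hcont := continuous_slice_circle hf hz
  obtain ⟨M, hM⟩ := (isCompact_Icc (a := (0 : ℝ)) (b := 2 * Real.pi)).exists_bound_of_continuousOn
    hcont.continuousOn
  -- Expanding only the factor `conj f` of `|f|²` avoids a double series: integrating each term
  -- against `f` is Cauchy's formula for the component.
  have key := intervalIntegral.hasSum_integral_of_dominated_convergence (μ := volume)
    (a := (0 : ℝ)) (b := 2 * Real.pi)
    (F := fun k θ => starRingEnd ℂ (homogComp k f z) *
      ((circleMap 0 1 θ ^ k)⁻¹ * f (circleMap 0 1 θ • z)))
    (f := fun θ => ((‖f (circleMap 0 1 θ • z)‖ ^ 2 : ℝ) : ℂ))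
    (fun k _ => ‖homogComp k f z‖ * M) ?_ ?_ ?_ ?_ ?_
  · rw [intervalIntegral.integral_ofReal] at key
    rw [← Complex.hasSum_ofReal]
    refine key.congr_fun fun k => ?_
    have hpi : (Real.pi : ℂ) ≠ 0 := by exact_mod_cast Real.pi_ne_zero
    have h1 := homogComp_eq_integral hf hz k
    rw [intervalIntegral.integral_const_mul]
    rw [eq_inv_mul_iff_mul_eq₀ (by simp)] at h1
    rw [← h1, mul_left_comm, Complex.conj_mul']
    push_cast
    ring
  · intro k
    have : Continuous fun θ : ℝ => (circleMap 0 1 θ ^ k)⁻¹ :=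
      Continuous.inv₀ (by fun_prop) fun θ => pow_ne_zero _ (circleMap_ne_center one_ne_zero)
    exact (continuous_const.mul (this.mul hcont)).aestronglyMeasurable
  · intro k
    refine Eventually.of_forall fun θ hθ => ?_
    rw [uIoc_of_le (by positivity)] at hθ
    have := hM θ ⟨hθ.1.le, hθ.2⟩
    simp only [norm_mul, RCLike.norm_conj, norm_inv, norm_pow, norm_circleMap_zero, abs_one,
      one_pow, inv_one, one_mul]
    gcongr
  · exact Eventually.of_forall fun θ _ => (summable_norm_homogComp hf hz).mul_right M
  · exact intervalIntegrable_const
  · refine Eventually.of_forall fun θ _ => ?_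
    have h1 := hasSum_homogComp hf h (t := circleMap 0 1 θ) (by simpa using hR)
    have h2 := ((Complex.hasSum_conj'.2 h1).mul_right (f (circleMap 0 1 θ • z)))
    rw [Complex.conj_mul'] at h2
    push_cast
    refine h2.congr_fun fun k => ?_
    have h3 : starRingEnd ℂ (circleMap 0 1 θ) = (circleMap 0 1 θ)⁻¹ := by
      rw [Complex.inv_def, Complex.normSq_eq_norm_sq]
      simp
    rw [map_mul, map_pow, h3, inv_pow, mul_assoc]

/-! ### Holomorphy of `N f`. -/

lemma norm_fderiv_le_of_norm_le {d : ℕ} {f : Cd d → ℂ} {w : Cd d} {r M : ℝ} (hr : 0 < r)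
    (hf : DifferentiableOn ℂ f (ball w r)) (hM : ∀ v ∈ ball w r, ‖f v‖ ≤ M) :
    ‖fderiv ℂ f w‖ ≤ 2 * M / r := by
  refine Complex.norm_fderiv_le_div_of_mapsTo_ball hf (fun v hv => ?_) hr
  rw [mem_closedBall, dist_eq_norm]
  have := hM v hv
  have := hM w (mem_ball_self hr)
  linarith [norm_sub_le (f v) (f w)]

/-- `N f z` is the derivative of `t ↦ f (t • z)` at `t = 1`, hence a Cauchy integral over `|t - 1| =
r` whose integrand is holomorphic in `z`; differentiate under the integral sign. -/
lemma HolomorphicOnBall.numberOp {d : ℕ} {f : Cd d → ℂ} (hf : HolomorphicOnBall d f) :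
    HolomorphicOnBall d (numberOp d f) := by
  intro z₀ hz₀
  refine DifferentiableAt.differentiableWithinAt ?_
  rw [unitBall, mem_ball_zero_iff] at hz₀
  have ha := norm_nonneg z₀
  -- The points `t • z` have norm at most `‖z₀‖ + 3r`; the derivative estimate there costs another
  -- `r`, and the last `r` keeps the compact ball inside the open unit ball.
  obtain ⟨r, hr0, hr1⟩ : ∃ r : ℝ, 0 < r ∧ ‖z₀‖ + 5 * r = 1 :=
    ⟨(1 - ‖z₀‖) / 5, by linarith, by ring⟩
  have hbig : ∀ z ∈ ball z₀ r, ∀ t ∈ closedBall (1 : ℂ) r, ‖t • z‖ ≤ ‖z₀‖ + 3 * r := by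
    intro z hz t ht
    have h1 : ‖z‖ ≤ ‖z₀‖ + r := by
      rw [mem_ball, dist_eq_norm] at hz
      linarith [norm_le_norm_add_norm_sub' z z₀]
    have h2 : ‖t‖ ≤ 1 + r := by
      rw [mem_closedBall, dist_eq_norm] at ht
      have := norm_le_norm_add_norm_sub' t 1
      rw [norm_one] at this
      linarith
    rw [norm_smul]
    calc ‖t‖ * ‖z‖ ≤ (1 + r) * (‖z₀‖ + r) := by gcongr
      _ ≤ _ := by nlinarith
  obtain ⟨M, hM⟩ := (isCompact_closedBall (0 : Cd d) (‖z₀‖ + 4 * r)).exists_bound_of_continuousOn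
    (hf.continuousOn.mono (closedBall_subset_ball (by linarith)))
  have hfd : ∀ w : Cd d, ‖w‖ ≤ ‖z₀‖ + 3 * r → ‖fderiv ℂ f w‖ ≤ 2 * M / r := by
    intro w hw
    have hsub : ball w r ⊆ closedBall 0 (‖z₀‖ + 4 * r) := fun v hv => by
      rw [mem_ball, dist_eq_norm] at hv
      rw [mem_closedBall_zero_iff]
      linarith [norm_le_norm_add_norm_sub' v w]
    exact norm_fderiv_le_of_norm_le hr0
      (hf.mono (hsub.trans (closedBall_subset_ball (by linarith)))) fun v hv => hM v (hsub hv)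
  have hγ : ∀ θ, circleMap (1 : ℂ) r θ ∈ closedBall (1 : ℂ) r :=
    fun θ => circleMap_mem_closedBall _ hr0.le θ
  have hmem : ∀ z ∈ ball z₀ r, ∀ t ∈ closedBall (1 : ℂ) r, t • z ∈ unitBall d := by
    intro z hz t ht
    rw [unitBall, mem_ball_zero_iff]
    linarith [hbig z hz t ht]
  set κ : ℝ → ℂ := fun θ => deriv (circleMap 1 r) θ * (1 / (circleMap 1 r θ - 1) ^ 2) with hκ
  have hκc : Continuous κ := by
    refine Continuous.mul ?_ (continuous_const.div (by fun_prop) fun θ =>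
      pow_ne_zero _ (sub_ne_zero.2 (circleMap_ne_center hr0.ne')))
    simp_rw [funext (deriv_circleMap (1 : ℂ) r)]
    fun_prop
  have hcont : ∀ z ∈ ball z₀ r, Continuous fun θ => κ θ * f (circleMap 1 r θ • z) := fun z hz =>
    hκc.mul (hf.continuousOn.comp_continuous (by fun_prop) fun θ => hmem z hz _ (hγ θ))
  obtain ⟨K, hK⟩ := (isCompact_Icc (a := (0 : ℝ)) (b := 2 * Real.pi)).exists_bound_of_continuousOn
    hκc.continuousOn
  have hfm : Measurable (fderiv ℂ f) := measurable_fderiv ℂ f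
  have hint := intervalIntegral.hasFDerivAt_integral_of_dominated_of_fderiv_le (𝕜 := ℂ)
    (a := 0) (b := 2 * Real.pi) (μ := volume)
    (F := fun z θ => κ θ * f (circleMap 1 r θ • z)) (x₀ := z₀) (s := ball z₀ r)
    (F' := fun z θ => (κ θ * circleMap 1 r θ) • fderiv ℂ f (circleMap 1 r θ • z))
    (bound := fun _ => K * (1 + r) * (2 * M / r)) (ball_mem_nhds _ hr0)
    ?_ ?_ ?_ ?_ ?_ ?_
  · have heq : (fun z => (2 * Real.pi * Complex.I : ℂ)⁻¹ *
        ∫ θ in (0 : ℝ)..2 * Real.pi, κ θ * f (circleMap 1 r θ • z)) =ᶠ[𝓝 z₀]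
        Bergman.numberOp d f := by
      filter_upwards [ball_mem_nhds z₀ hr0] with z hz
      have hd : DifferentiableOn ℂ (fun t : ℂ => f (t • z)) (closedBall 1 r) :=
        DifferentiableOn.comp (t := unitBall d) hf (by fun_prop) fun t ht => hmem z hz t ht
      have h1 := hd.deriv_eq_smul_circleIntegral hr0
      have h2 := numberOp_smul (hf.differentiableAt (hmem z hz 1 (mem_closedBall_self hr0.le)))
      simp only [one_smul, one_mul] at h2
      have h3 : (2 * Real.pi * Complex.I : ℂ) ≠ 0 := by simp [Real.pi_ne_zero]
      rw [h2, inv_mul_eq_iff_eq_mul₀ h3, ← smul_eq_mul (2 * _ * _) (deriv _ _), ← h1,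
        circleIntegral]
      simp only [hκ, smul_eq_mul, mul_assoc]
    exact (heq.differentiableAt_iff).1 (hint.differentiableAt.const_mul _)
  · filter_upwards [ball_mem_nhds z₀ hr0] with z hz
    exact (hcont z hz).aestronglyMeasurable
  · exact (hcont z₀ (mem_ball_self hr0)).intervalIntegrable _ _
  · have : Measurable fun θ : ℝ => fderiv ℂ f (circleMap 1 r θ • z₀) :=
      hfm.comp (by fun_prop : Continuous fun θ : ℝ => circleMap 1 r θ • z₀).measurable
    exact ((by fun_prop : Continuous fun θ => κ θ * circleMap 1 r θ).aestronglyMeasurable).smul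
      this.aestronglyMeasurable
  · refine Eventually.of_forall fun θ hθ z hz => ?_
    rw [uIoc_of_le (by positivity)] at hθ
    have h1 := hK θ ⟨hθ.1.le, hθ.2⟩
    have h2 := hfd _ (hbig z hz _ (hγ θ))
    have h3 : ‖circleMap 1 r θ‖ ≤ 1 + r := by
      have := hγ θ
      rw [mem_closedBall, dist_eq_norm] at this
      have h4 := norm_le_norm_add_norm_sub' (circleMap 1 r θ) 1
      rw [norm_one] at h4
      linarith
    rw [norm_smul, norm_mul]
    have := (norm_nonneg _).trans h1
    gcongr
  · exact intervalIntegrable_const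
  · refine Eventually.of_forall fun θ _ z hz => ?_
    have h1 := (hf.differentiableAt (hmem z hz _ (hγ θ))).hasFDerivAt
    have h2 : HasFDerivAt (fun z : Cd d => circleMap 1 r θ • z)
      (circleMap 1 r θ • ContinuousLinearMap.id ℂ (Cd d)) z :=
      (hasFDerivAt_id (𝕜 := ℂ) z).const_smul (circleMap 1 r θ)
    have h3 := (h1.comp z h2).const_mul (κ θ)
    have h4 : (κ θ * circleMap 1 r θ) • fderiv ℂ f (circleMap 1 r θ • z) = κ θ •
        (fderiv ℂ f (circleMap 1 r θ • z)).comp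
          (circleMap 1 r θ • ContinuousLinearMap.id ℂ (Cd d)) := by
      ext v
      simp [mul_assoc]
    rw [h4]
    exact h3

/-! ### The measures `μ_λ`: radial density and rotation invariance. -/

lemma measurableSet_unitBall {d : ℕ} : MeasurableSet (unitBall d) := measurableSet_ball

lemma one_sub_norm_sq_pos {d : ℕ} {z : Cd d} (hz : z ∈ unitBall d) : 0 < 1 - ‖z‖ ^ 2 := by
  rw [unitBall, mem_ball_zero_iff] at hz
  nlinarith [norm_nonneg z]

lemma normConst_pos {d : ℕ} {lam : ℝ} (h : (d : ℝ) < lam) : 0 < normConst d lam := by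
  have h0 : (0 : ℝ) < lam := (Nat.cast_nonneg d).trans_lt h
  exact div_pos (Real.Gamma_pos_of_pos h0)
    (mul_pos (pow_pos Real.pi_pos _) (Real.Gamma_pos_of_pos (sub_pos.2 h)))

/-- The density of `mu d lam` with respect to Lebesgue measure on the ball, as a function of
the norm. -/
noncomputable def radialDensity (d : ℕ) (lam : ℝ) (r : ℝ) : ENNReal :=
  ENNReal.ofReal (normConst d lam * (1 - r ^ 2) ^ (lam - (d + 1)))

lemma measurable_radialDensity (d : ℕ) (lam : ℝ) : Measurable (radialDensity d lam) := by
  unfold radialDensity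
  fun_prop

lemma mu_eq_withDensity (d : ℕ) (lam : ℝ) :
    mu d lam = (volume.restrict (unitBall d)).withDensity fun z => radialDensity d lam ‖z‖ := by
  rw [mu, tau, ← withDensity_mul _ (by fun_prop) (by fun_prop)]
  refine withDensity_congr_ae ?_
  filter_upwards [ae_restrict_mem measurableSet_unitBall] with z hz
  have h := one_sub_norm_sq_pos hz
  rw [Pi.mul_apply, radialDensity, ← ENNReal.ofReal_mul (by positivity), mul_left_comm,
    ← Real.rpow_add h]
  congr 3
  ring

lemma ae_mem_unitBall (d : ℕ) (lam : ℝ) : ∀ᵐ z ∂(mu d lam), z ∈ unitBall d := by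
  rw [mu_eq_withDensity]
  exact (withDensity_absolutelyContinuous _ _).ae_le (ae_restrict_mem measurableSet_unitBall)

instance (d : ℕ) (lam : ℝ) : SFinite (mu d lam) := by
  rw [mu_eq_withDensity]
  infer_instance

lemma lintegral_mu (d : ℕ) (lam : ℝ) (h : Cd d → ENNReal) :
    ∫⁻ z, h z ∂(mu d lam) = ∫⁻ z, (unitBall d).indicator
      (fun z => radialDensity d lam ‖z‖ * h z) z := by
  rw [mu_eq_withDensity, lintegral_withDensity_eq_lintegral_mul_non_measurable _
    (f := fun z : Cd d => radialDensity d lam ‖z‖)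
    ((measurable_radialDensity d lam).comp measurable_norm)
    (Eventually.of_forall fun z => ENNReal.ofReal_lt_top),
    lintegral_indicator measurableSet_unitBall]
  rfl

/-- Multiplication by a unimodular scalar, as a real-linear isometry. -/
noncomputable def rotation (d : ℕ) {c : ℂ} (hc : ‖c‖ = 1) : Cd d ≃ₗᵢ[ℝ] Cd d where
  toLinearEquiv := (LinearEquiv.smulOfNeZero ℂ (Cd d) c
    (norm_ne_zero_iff.1 (hc ▸ one_ne_zero))).restrictScalars ℝ
  norm_map' z := by
    change ‖c • z‖ = ‖z‖
    rw [norm_smul, hc, one_mul]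

lemma lintegral_mu_rotation {d : ℕ} (lam : ℝ) {c : ℂ} (hc : ‖c‖ = 1) (h : Cd d → ENNReal) :
    ∫⁻ z, h (c • z) ∂(mu d lam) = ∫⁻ z, h z ∂(mu d lam) := by
  have hn : ∀ z : Cd d, ‖c • z‖ = ‖z‖ := fun z => by rw [norm_smul, hc, one_mul]
  rw [lintegral_mu, lintegral_mu, ← ((rotation d hc).measurePreserving).lintegral_comp_emb
    (rotation d hc).toHomeomorph.measurableEmbedding
    ((unitBall d).indicator fun z => radialDensity d lam ‖z‖ * h z)]
  refine lintegral_congr fun z => ?_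
  change _ = (unitBall d).indicator (fun z => radialDensity d lam ‖z‖ * h z) (c • z)
  simp only [indicator, unitBall, mem_ball_zero_iff, hn]

/-! ### Measurability of components and Parseval on the ball. -/

lemma measurable_indicator_ball {d : ℕ} {f : Cd d → ℂ} (hf : HolomorphicOnBall d f) :
    Measurable ((unitBall d).indicator f) := by
  classical
  rw [← piecewise_eq_indicator]
  exact ContinuousOn.measurable_piecewise hf.continuousOn continuousOn_const measurableSet_unitBall

/-- On the ball the component is a parametrized Cauchy integral. Homogeneity extends this to the
whole space, as a limit of rescalings that is eventually constant at each point. -/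
lemma measurable_homogComp {d : ℕ} {f : Cd d → ℂ} (hf : HolomorphicOnBall d f) (k : ℕ) :
    Measurable (homogComp k f) := by
  set G : Cd d → ℂ := fun z => (2 * Real.pi : ℂ)⁻¹ *
    ∫ θ in (0 : ℝ)..2 * Real.pi, (circleMap 0 1 θ ^ k)⁻¹ *
      (unitBall d).indicator f (circleMap 0 1 θ • z) with hG
  have hGm : Measurable G := by
    refine Measurable.const_mul ?_ _
    simp_rw [intervalIntegral.integral_of_le (by positivity : (0 : ℝ) ≤ 2 * Real.pi)]
    refine (StronglyMeasurable.integral_prod_right (f := fun z θ => (circleMap 0 1 θ ^ k)⁻¹ *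
      (unitBall d).indicator f (circleMap 0 1 θ • z)) ?_).measurable
    refine Measurable.stronglyMeasurable ?_
    have h1 : Measurable fun p : Cd d × ℝ => circleMap 0 1 p.2 • p.1 :=
      (by fun_prop : Continuous fun p : Cd d × ℝ => circleMap 0 1 p.2 • p.1).measurable
    have h2 : Measurable fun p : Cd d × ℝ => (circleMap 0 1 p.2 ^ k)⁻¹ :=
      (by fun_prop : Continuous fun p : Cd d × ℝ => circleMap 0 1 p.2 ^ k).measurable.inv
    exact h2.mul ((measurable_indicator_ball hf).comp h1)
  have hGe : ∀ z ∈ unitBall d, G z = homogComp k f z := by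
    intro z hz
    rw [homogComp_eq_integral hf hz]
    simp only [hG]
    congr 2
    funext θ
    rw [indicator_of_mem (circleMap_zero_one_smul_mem hz θ)]
  have hlim : Tendsto (fun (m : ℕ) z => ((m : ℂ) + 1) ^ k * G (((m : ℂ) + 1)⁻¹ • z)) atTop
      (𝓝 (homogComp k f)) := by
    rw [tendsto_pi_nhds]
    intro z
    refine tendsto_const_nhds.congr' ?_
    obtain ⟨n, hn⟩ := exists_nat_gt ‖z‖
    filter_upwards [eventually_ge_atTop n] with m hm
    have hm0 : (m : ℂ) + 1 ≠ 0 := by exact_mod_cast m.succ_ne_zero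
    have hm1 : ‖(m : ℂ) + 1‖ = m + 1 := by
      have : (m : ℂ) + 1 = ((m + 1 : ℝ) : ℂ) := by push_cast; rfl
      rw [this, Complex.norm_real, Real.norm_of_nonneg (by positivity)]
    rw [hGe, homogComp_smul, ← mul_assoc, ← mul_pow, mul_inv_cancel₀ hm0, one_pow, one_mul]
    rw [unitBall, mem_ball_zero_iff, norm_smul, norm_inv, hm1, inv_mul_lt_iff₀ (by positivity)]
    have : (n : ℝ) ≤ m := by exact_mod_cast hm
    linarith
  refine measurable_of_tendsto_metrizable (fun m => ?_) hlim
  exact (hGm.comp (measurable_const_smul _)).const_mul _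

lemma enorm_sq_eq_ofReal (w : ℂ) : ‖w‖ₑ ^ 2 = ENNReal.ofReal (‖w‖ ^ 2) := by
  rw [ENNReal.ofReal_pow (norm_nonneg _), ofReal_norm]

lemma lintegral_circle_enorm_sq {d : ℕ} {f : Cd d → ℂ} (hf : HolomorphicOnBall d f) {z : Cd d}
    (hz : z ∈ unitBall d) :
    ∫⁻ θ in Ioc (0 : ℝ) (2 * Real.pi), ‖f (circleMap 0 1 θ • z)‖ₑ ^ 2 =
      ∑' k, ENNReal.ofReal (2 * Real.pi) * ‖homogComp k f z‖ₑ ^ 2 := by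
  have h := hasSum_norm_sq_homogComp hf hz
  simp_rw [enorm_sq_eq_ofReal, ← ENNReal.ofReal_mul Real.two_pi_pos.le]
  rw [← ENNReal.ofReal_tsum_of_nonneg (fun k => by positivity) h.summable, h.tsum_eq,
    intervalIntegral.integral_of_le Real.two_pi_pos.le, ofReal_integral_eq_lintegral_ofReal]
  · have := (continuous_slice_circle hf hz).norm.pow 2
    exact (this.intervalIntegrable 0 (2 * Real.pi)).1
  · exact Eventually.of_forall fun θ => by positivity

/-- Parseval's identity for the decomposition into homogeneous components. -/
lemma lintegral_enorm_sq_eq_tsum {d : ℕ} (lam : ℝ) {f : Cd d → ℂ} (hf : HolomorphicOnBall d f) :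
    ∫⁻ z, ‖f z‖ₑ ^ 2 ∂(mu d lam) = ∑' k, ∫⁻ z, ‖homogComp k f z‖ₑ ^ 2 ∂(mu d lam) := by
  have hpi : ENNReal.ofReal (2 * Real.pi) ≠ 0 := by simpa using Real.pi_pos
  refine (ENNReal.mul_right_inj hpi ENNReal.ofReal_ne_top).1 ?_
  set F : Cd d → ℂ := (unitBall d).indicator f
  have hmeas : Measurable fun p : ℝ × Cd d => ‖F (circleMap 0 1 p.1 • p.2)‖ₑ ^ 2 :=
    ((measurable_indicator_ball hf).comp (by fun_prop :
      Continuous fun p : ℝ × Cd d => circleMap 0 1 p.1 • p.2).measurable).enorm.pow_const 2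
  -- Average over rotations, exchange by Tonelli, and apply Parseval on each circle. No
  -- integrability is assumed, so the identity also decides membership.
  calc ENNReal.ofReal (2 * Real.pi) * ∫⁻ z, ‖f z‖ₑ ^ 2 ∂(mu d lam)
      = ∫⁻ θ in Ioc (0 : ℝ) (2 * Real.pi), ∫⁻ z, ‖F (circleMap 0 1 θ • z)‖ₑ ^ 2 ∂(mu d lam) := by
        have h1 : ∀ θ : ℝ, ∫⁻ z, ‖F (circleMap 0 1 θ • z)‖ₑ ^ 2 ∂(mu d lam) =
            ∫⁻ z, ‖f z‖ₑ ^ 2 ∂(mu d lam) := by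
          intro θ
          rw [lintegral_mu_rotation lam (by simp : ‖circleMap 0 1 θ‖ = 1)
            (fun z => ‖F z‖ₑ ^ 2)]
          refine lintegral_congr_ae ?_
          filter_upwards [ae_mem_unitBall d lam] with z hz
          simp [F, indicator_of_mem hz]
        simp_rw [h1]
        rw [setLIntegral_const, Real.volume_Ioc, sub_zero, mul_comm]
    _ = ∫⁻ z, (∫⁻ θ in Ioc (0 : ℝ) (2 * Real.pi), ‖F (circleMap 0 1 θ • z)‖ₑ ^ 2)
          ∂(mu d lam) :=
        lintegral_lintegral_swap hmeas.aemeasurable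
    _ = ∫⁻ z, ∑' k, ENNReal.ofReal (2 * Real.pi) * ‖homogComp k f z‖ₑ ^ 2 ∂(mu d lam) := by
        refine lintegral_congr_ae ?_
        filter_upwards [ae_mem_unitBall d lam] with z hz
        simp only [F, indicator_of_mem (circleMap_zero_one_smul_mem hz _)]
        exact lintegral_circle_enorm_sq hf hz
    _ = _ := by
        have hm := fun k => ((measurable_homogComp hf k).enorm.pow_const 2)
        rw [lintegral_tsum fun k => ((hm k).const_mul _).aemeasurable, ← ENNReal.tsum_mul_left]
        exact tsum_congr fun k => lintegral_const_mul _ (hm k)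

lemma memLp_two_iff {d : ℕ} {ν : Measure (Cd d)} {f : Cd d → ℂ} (hf : AEStronglyMeasurable f ν) :
    MemLp f 2 ν ↔ ∫⁻ z, ‖f z‖ₑ ^ 2 ∂ν < ⊤ := by
  have h := eLpNorm_lt_top_iff_lintegral_rpow_enorm_lt_top (f := f) (μ := ν) (p := 2) (by simp)
    (by simp)
  simp only [ENNReal.toReal_ofNat, ENNReal.rpow_ofNat] at h
  rw [← h]
  exact ⟨fun h => h.2, fun h => ⟨hf, h⟩⟩

lemma HolomorphicOnBall.aestronglyMeasurable {d : ℕ} (lam : ℝ) {f : Cd d → ℂ}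
    (hf : HolomorphicOnBall d f) : AEStronglyMeasurable f (mu d lam) := by
  refine ⟨(unitBall d).indicator f, (measurable_indicator_ball hf).stronglyMeasurable, ?_⟩
  filter_upwards [ae_mem_unitBall d lam] with z hz
  rw [indicator_of_mem hz]

lemma memHL2_iff {d : ℕ} {lam : ℝ} {f : Cd d → ℂ} (hf : HolomorphicOnBall d f) :
    MemHL2 d lam f ↔ ∫⁻ z, ‖f z‖ₑ ^ 2 ∂(mu d lam) < ⊤ := by
  rw [MemHL2, memLp_two_iff (hf.aestronglyMeasurable lam)]
  exact and_iff_right hf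

/-! ### Radial integrals and the recursion in `λ`. -/

lemma intervalIntegrable_pow_mul_rpow (p : ℕ) {s : ℝ} (hs : 0 < s) :
    IntervalIntegrable (fun r : ℝ => r ^ p * (1 - r ^ 2) ^ (s - 1)) volume 0 1 := by
  have h1 : IntervalIntegrable (fun r : ℝ => (1 - r) ^ (s - 1)) volume 0 1 := by
    have := (intervalIntegral.intervalIntegrable_rpow' (a := 1) (b := 0)
      (by linarith : -1 < s - 1)).comp_sub_left 1
    simpa using this
  have h2 : ContinuousOn (fun r : ℝ => r ^ p * (1 + r) ^ (s - 1)) (uIcc 0 1) := by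
    refine ContinuousOn.mul (by fun_prop) (ContinuousOn.rpow_const (by fun_prop) fun r hr => ?_)
    rw [uIcc_of_le zero_le_one] at hr
    left
    linarith [hr.1]
  refine (h1.mul_continuousOn h2).congr fun r hr => ?_
  rw [uIoc_of_le zero_le_one] at hr
  have h3 : 1 - r ^ 2 = (1 - r) * (1 + r) := by ring
  rw [h3, Real.mul_rpow (by linarith [hr.2]) (by linarith [hr.1])]
  ring

/-- Integrate the derivative of `r^(2m+2) (1 - r²)^s` over `[0, 1]`: the boundary terms vanish, and
`r² = 1 - (1 - r²)` rewrites the result in the two integrals. -/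
lemma integral_pow_mul_rpow_succ (m : ℕ) {s : ℝ} (hs : 0 < s) :
    s * ∫ r in (0 : ℝ)..1, r ^ (2 * m + 1) * (1 - r ^ 2) ^ (s - 1) =
      (m + 1 + s) * ∫ r in (0 : ℝ)..1, r ^ (2 * m + 1) * (1 - r ^ 2) ^ s := by
  have hi1 := intervalIntegrable_pow_mul_rpow (2 * m + 1) hs
  have hi2 := intervalIntegrable_pow_mul_rpow (2 * m + 1) (s := s + 1) (by linarith)
  rw [add_sub_cancel_right] at hi2
  have key := intervalIntegral.integral_eq_sub_of_hasDerivAt_of_le (a := 0) (b := 1)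
    (f := fun r : ℝ => r ^ (2 * m + 2) * (1 - r ^ 2) ^ s)
    (f' := fun r => 2 * (m + 1 + s) * (r ^ (2 * m + 1) * (1 - r ^ 2) ^ s) -
      2 * s * (r ^ (2 * m + 1) * (1 - r ^ 2) ^ (s - 1))) zero_le_one ?_ ?_
      ((hi2.const_mul _).sub (hi1.const_mul _))
  · rw [intervalIntegral.integral_sub (hi2.const_mul _) (hi1.const_mul _),
      intervalIntegral.integral_const_mul, intervalIntegral.integral_const_mul] at key
    simp [Real.zero_rpow hs.ne'] at key
    linarith
  · exact ContinuousOn.mul (by fun_prop) (ContinuousOn.rpow_const (by fun_prop)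
      fun r _ => Or.inr hs.le)
  · intro r hr
    have hpos : 0 < 1 - r ^ 2 := by nlinarith [hr.1, hr.2]
    have h1 : HasDerivAt (fun r : ℝ => 1 - r ^ 2) (-(2 * r)) r := by
      simpa using (hasDerivAt_pow 2 r).const_sub 1
    have h2 := (hasDerivAt_pow (2 * m + 2) r).mul (h1.rpow_const (p := s) (Or.inl hpos.ne'))
    refine h2.congr_deriv ?_
    have h3 : (1 - r ^ 2) ^ s = (1 - r ^ 2) ^ (s - 1) * (1 - r ^ 2) := by
      rw [← Real.rpow_add_one hpos.ne', sub_add_cancel]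
    rw [h3]
    push_cast
    ring

lemma normConst_succ {d : ℕ} {lam : ℝ} (h : (d : ℝ) < lam) :
    normConst d (lam + 1) * (lam - d) = normConst d lam * lam := by
  have h0 : (0 : ℝ) < lam := (Nat.cast_nonneg d).trans_lt h
  have hs : 0 < lam - d := sub_pos.2 h
  have hg := (Real.Gamma_pos_of_pos hs).ne'
  have hpi := Real.pi_ne_zero
  rw [normConst, normConst, Real.Gamma_add_one h0.ne', show lam + 1 - d = (lam - d) + 1 by ring,
    Real.Gamma_add_one hs.ne']
  field_simp

/-- The radial part of the squared norm of a homogeneous function of degree `k`. -/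
noncomputable def radialIntegral (d : ℕ) (lam : ℝ) (k : ℕ) : ENNReal :=
  ∫⁻ r in Ioo (0 : ℝ) 1, ENNReal.ofReal (r ^ (2 * d - 1)) *
    (ENNReal.ofReal (r ^ (2 * k)) * radialDensity d lam r)

lemma radialIntegral_eq {d : ℕ} {lam : ℝ} (h : (d : ℝ) + 1 < lam) (k : ℕ) :
    radialIntegral (d + 1) lam k = ENNReal.ofReal (normConst (d + 1) lam *
      ∫ r in (0 : ℝ)..1, r ^ (2 * (k + d) + 1) * (1 - r ^ 2) ^ (lam - (d + 1) - 1)) := by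
  have hi := intervalIntegrable_pow_mul_rpow (2 * (k + d) + 1) (sub_pos.2 h)
  have hc := normConst_pos (d := d + 1) (lam := lam) (by exact_mod_cast h)
  rw [← intervalIntegral.integral_const_mul, intervalIntegral.integral_of_le zero_le_one,
    ← restrict_Ioo_eq_restrict_Ioc, ofReal_integral_eq_lintegral_ofReal, radialIntegral]
  · refine setLIntegral_congr_fun measurableSet_Ioo fun r hr => ?_
    have hr0 := hr.1
    have hpos : 0 < 1 - r ^ 2 := by nlinarith [hr.1, hr.2]
    simp only [radialDensity]
    rw [← ENNReal.ofReal_mul (by positivity), ← ENNReal.ofReal_mul (by positivity)]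
    congr 1
    rw [show 2 * (d + 1) - 1 = 2 * d + 1 by omega,
      show lam - (((d + 1 : ℕ) : ℝ) + 1) = lam - (d + 1) - 1 by push_cast; ring]
    ring
  · exact ((hi.const_mul _).1).mono_set Ioo_subset_Ioc_self
  · filter_upwards [ae_restrict_mem measurableSet_Ioo] with r hr
    have hr0 := hr.1
    have hpos : 0 < 1 - r ^ 2 := by nlinarith [hr.1, hr.2]
    simp only [Pi.zero_apply]
    positivity

/-- The integrals contribute the ratio `(λ + k) / (λ - (d+1))` and the normalizing constants `(λ -
(d+1)) / λ`, so the dimension cancels. -/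
lemma radialIntegral_succ {d : ℕ} {lam : ℝ} (h : (d : ℝ) + 1 < lam) (k : ℕ) :
    radialIntegral (d + 1) lam k =
      ENNReal.ofReal (1 + k / lam) * radialIntegral (d + 1) (lam + 1) k := by
  have h0 : (0 : ℝ) < lam := by have := Nat.cast_nonneg (α := ℝ) d; linarith
  have hs : 0 < lam - (d + 1) := sub_pos.2 h
  rw [radialIntegral_eq h, radialIntegral_eq (h.trans (lt_add_one lam)),
    ← ENNReal.ofReal_mul (by positivity)]
  congr 1
  have h1 := integral_pow_mul_rpow_succ (k + d) hs
  have h2 := normConst_succ (d := d + 1) (lam := lam) (by exact_mod_cast h)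
  rw [show lam + 1 - ((d : ℝ) + 1) - 1 = lam - (d + 1) by ring]
  set I := ∫ r in (0 : ℝ)..1, r ^ (2 * (k + d) + 1) * (1 - r ^ 2) ^ (lam - (d + 1) - 1)
  set J := ∫ r in (0 : ℝ)..1, r ^ (2 * (k + d) + 1) * (1 - r ^ 2) ^ (lam - (d + 1))
  push_cast at h1 h2
  rw [← mul_left_cancel_iff_of_pos h0]
  calc lam * (normConst (d + 1) lam * I) = (normConst (d + 1) lam * lam) * I := by ring
    _ = normConst (d + 1) (lam + 1) * ((lam - (d + 1)) * I) := by rw [← h2]; ring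
    _ = normConst (d + 1) (lam + 1) * ((lam + k) * J) := by rw [h1]; ring
    _ = _ := by field_simp

/-- Polar coordinates; the point is that the spherical factor is independent of `lam`. -/
lemma lintegral_mu_homogeneous {d : ℕ} (lam : ℝ) {F : Cd (d + 1) → ℂ} (hF : Measurable F) {k : ℕ}
    (hk : ∀ (c : ℂ) z, F (c • z) = c ^ k * F z) :
    ∫⁻ z, ‖F z‖ₑ ^ 2 ∂(mu (d + 1) lam) =
      (∫⁻ ω, ‖F ω.1‖ₑ ^ 2 ∂(volume : Measure (Cd (d + 1))).toSphere) *
        radialIntegral (d + 1) lam k := by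
  have hfin : Module.finrank ℝ (Cd (d + 1)) = 2 * (d + 1) := by
    rw [finrank_real_of_complex]; simp
  set h : Cd (d + 1) → ENNReal := (unitBall (d + 1)).indicator
    (fun z => radialDensity (d + 1) lam ‖z‖ * ‖F z‖ₑ ^ 2) with hh
  set g : ℝ → ENNReal := (Iio 1).indicator
    (fun r => ENNReal.ofReal (r ^ (2 * k)) * radialDensity (d + 1) lam r) with hg
  have hgm : Measurable g :=
    Measurable.indicator ((by fun_prop : Measurable fun r : ℝ => ENNReal.ofReal (r ^ (2 * k))).mul
      (measurable_radialDensity _ _)) measurableSet_Iio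
  have hpt : ∀ p : sphere (0 : Cd (d + 1)) 1 × Ioi (0 : ℝ),
      h ((homeomorphUnitSphereProd (Cd (d + 1))).symm p) = ‖F p.1.1‖ₑ ^ 2 * g p.2.1 := by
    rintro ⟨⟨ω, hω⟩, r, hr⟩
    rw [mem_sphere_zero_iff_norm] at hω
    have hr' : (0 : ℝ) < r := hr
    have hn : ‖r • ω‖ = r := by rw [norm_smul, hω, mul_one, Real.norm_of_nonneg hr'.le]
    rw [homeomorphUnitSphereProd_symm_apply_coe]
    simp only [hh, hg, indicator, unitBall, mem_ball_zero_iff, hn, mem_Iio]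
    split_ifs
    · have : r • ω = (r : ℂ) • ω := (Complex.coe_smul r ω).symm
      rw [this, hk, enorm_mul, mul_pow, enorm_sq_eq_ofReal ((r : ℂ) ^ k), norm_pow,
        Complex.norm_real, Real.norm_of_nonneg hr'.le, ← pow_mul, mul_comm k 2]
      ring
    · simp
  have hpt' : ∀ x : ({0}ᶜ : Set (Cd (d + 1))), h x =
      (fun p : sphere (0 : Cd (d + 1)) 1 × Ioi (0 : ℝ) => ‖F p.1.1‖ₑ ^ 2 * g p.2.1)
        (homeomorphUnitSphereProd (Cd (d + 1)) x) := fun x => by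
    simp only [← hpt, Homeomorph.symm_apply_apply]
  have hpolar : ∫⁻ z, h z =
      ∫⁻ p : sphere (0 : Cd (d + 1)) 1 × Ioi (0 : ℝ), ‖F p.1.1‖ₑ ^ 2 * g p.2.1
        ∂((volume : Measure (Cd (d + 1))).toSphere.prod
        (Measure.volumeIoiPow (Module.finrank ℝ (Cd (d + 1)) - 1))) := by
    rw [← (Measure.measurePreserving_homeomorphUnitSphereProd
        (volume : Measure (Cd (d + 1)))).lintegral_comp_emb
        (homeomorphUnitSphereProd (Cd (d + 1))).measurableEmbedding, ← lintegral_congr hpt',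
      lintegral_subtype_comap (measurableSet_singleton _).compl, restrict_compl_singleton]
  rw [lintegral_mu, hpolar]
  rw [lintegral_prod_mul (f := fun ω : sphere (0 : Cd (d + 1)) 1 => ‖F ω.1‖ₑ ^ 2)
    (g := fun r : Ioi (0 : ℝ) => g r.1)
    ((hF.comp measurable_subtype_coe).enorm.pow_const 2).aemeasurable
    (hgm.comp measurable_subtype_coe).aemeasurable]
  congr 1
  rw [Measure.volumeIoiPow, lintegral_withDensity_eq_lintegral_mul_non_measurable _
    (by fun_prop) (Eventually.of_forall fun r => ENNReal.ofReal_lt_top)]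
  simp only [Pi.mul_apply]
  rw [lintegral_subtype_comap measurableSet_Ioi (f := fun r : ℝ =>
    ENNReal.ofReal (r ^ (Module.finrank ℝ (Cd (d + 1)) - 1)) * g r), hfin, radialIntegral,
    ← Iio_inter_Ioi, ← setLIntegral_indicator measurableSet_Iio]
  refine lintegral_congr fun r => ?_
  simp only [hg, indicator]
  split_ifs <;> simp

lemma lintegral_mu_succ {d : ℕ} {lam : ℝ} (h : (d : ℝ) < lam) {F : Cd d → ℂ} (hF : Measurable F)
    {k : ℕ} (hk : ∀ (c : ℂ) z, F (c • z) = c ^ k * F z) :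
    ∫⁻ z, ‖F z‖ₑ ^ 2 ∂(mu d lam) =
      ENNReal.ofReal (1 + k / lam) * ∫⁻ z, ‖F z‖ₑ ^ 2 ∂(mu d (lam + 1)) := by
  cases d with
  -- Dimension zero has no usable polar coordinates: the space is a point, the density is `1`, and
  -- homogeneity forces `F = 0` unless `k = 0`.
  | zero =>
    have hmu : ∀ s : ℝ, 0 < s → mu 0 s = volume.restrict (unitBall 0) := by
      intro s hs
      have : (fun z : Cd 0 => radialDensity 0 s ‖z‖) = 1 := by
        funext z
        have hg := (Real.Gamma_pos_of_pos hs).ne'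
        simp [radialDensity, normConst, Subsingleton.elim z 0, hg]
      rw [mu_eq_withDensity, this, withDensity_one]
    have h0 : 0 < lam := by simpa using h
    rw [hmu lam h0, hmu (lam + 1) (by linarith)]
    rcases Nat.eq_zero_or_pos k with rfl | hk0
    · simp
    · have : ∀ z, F z = 0 := fun z => by
        have := hk 0 z
        rwa [zero_pow hk0.ne', zero_mul, Subsingleton.elim ((0 : ℂ) • z) z] at this
      simp [this]
  | succ d =>
    rw [lintegral_mu_homogeneous lam hF hk, lintegral_mu_homogeneous (lam + 1) hF hk,
      radialIntegral_succ (by exact_mod_cast h)]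
    ring

/-! ### Eigenvalues: factorization and growth. -/

/-- The eigenvalue of `shiftProd d s m` on homogeneous functions of degree `k`. -/
noncomputable def shiftEigenvalue (s : ℝ) (m k : ℕ) : ℝ := ∏ j ∈ Finset.range m, (1 + k / (s + j))

lemma shiftEigenvalue_succ (s : ℝ) (m k : ℕ) :
    shiftEigenvalue s (m + 1) k = shiftEigenvalue s m k * (1 + k / (s + m)) :=
  Finset.prod_range_succ _ _

/-- With `s = λ` and `m = n`, this splits the norm ratio between levels `λ` and `λ + 2n` into the
eigenvalues of `B` and `A`. -/
lemma shiftEigenvalue_add (s : ℝ) (m n k : ℕ) :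
    shiftEigenvalue s (m + n) k = shiftEigenvalue s m k * shiftEigenvalue (s + m) n k := by
  simp only [shiftEigenvalue, Finset.prod_range_add, Nat.cast_add, add_assoc]

lemma shiftEigenvalue_pos {s : ℝ} (hs : 0 < s) (m k : ℕ) : 0 < shiftEigenvalue s m k :=
  Finset.prod_pos fun j _ => by positivity

lemma lintegral_mu_add {d : ℕ} {lam : ℝ} (h : (d : ℝ) < lam) {F : Cd d → ℂ} (hF : Measurable F)
    {k : ℕ} (hk : ∀ (c : ℂ) z, F (c • z) = c ^ k * F z) (m : ℕ) :
    ∫⁻ z, ‖F z‖ₑ ^ 2 ∂(mu d lam) =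
      ENNReal.ofReal (shiftEigenvalue lam m k) * ∫⁻ z, ‖F z‖ₑ ^ 2 ∂(mu d (lam + m)) := by
  have h0 : (0 : ℝ) < lam := (Nat.cast_nonneg d).trans_lt h
  induction m with
  | zero => simp [shiftEigenvalue]
  | succ m ih =>
    have hm := Nat.cast_nonneg (α := ℝ) m
    rw [ih, lintegral_mu_succ (by linarith) hF hk, ← mul_assoc,
      ← ENNReal.ofReal_mul (shiftEigenvalue_pos h0 m k).le, shiftEigenvalue_succ, Nat.cast_succ,
      add_assoc]

lemma shiftEigenvalue_le {s : ℝ} (hs : 0 < s) (m k : ℕ) :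
    shiftEigenvalue s m k ≤ ((1 + 1 / s) * (1 + k)) ^ m := by
  refine (Finset.prod_le_prod (fun j _ => by positivity) fun j _ => ?_).trans_eq
    (by rw [Finset.prod_const, Finset.card_range])
  have h1 : (k : ℝ) / (s + j) ≤ k / s := by
    gcongr
    linarith [Nat.cast_nonneg (α := ℝ) j]
  have h2 : (1 + 1 / s) * (1 + k) = 1 + k / s + (k + 1 / s) := by ring
  have h3 : 0 ≤ (k : ℝ) + 1 / s := by positivity
  linarith

/-- Together with `shiftEigenvalue_le`, this shows growth of exact order `(1 + k)^m`, with constants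
independent of `k`. -/
lemma le_shiftEigenvalue {s : ℝ} (hs : 0 < s) (m k : ℕ) :
    ((1 + k) / (1 + s + m)) ^ m ≤ shiftEigenvalue s m k := by
  refine Eq.trans_le (by rw [Finset.prod_const, Finset.card_range])
    (Finset.prod_le_prod (s := Finset.range m) (f := fun _ => (1 + (k : ℝ)) / (1 + s + m))
      (fun j _ => by positivity) fun j hj => ?_)
  have hj' : (j : ℝ) ≤ m := by exact_mod_cast (Finset.mem_range.1 hj).le
  have h1 : (1 : ℝ) / (1 + s + m) ≤ 1 := by
    rw [div_le_one (by positivity)]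
    linarith [Nat.cast_nonneg (α := ℝ) m]
  have h2 : (k : ℝ) / (1 + s + m) ≤ k / (s + j) := by
    gcongr
    linarith
  rw [add_div]
  exact add_le_add h1 h2

lemma HolomorphicOnBall.add_const_mul {d : ℕ} {f g : Cd d → ℂ} (hf : HolomorphicOnBall d f)
    (hg : HolomorphicOnBall d g) (c : ℂ) : HolomorphicOnBall d fun z => f z + c * g z :=
  DifferentiableOn.add hf (DifferentiableOn.const_mul hg c)

lemma shiftFactor_eq (d : ℕ) (s : ℝ) (f : Cd d → ℂ) :
    shiftFactor d s f = fun z => f z + (s : ℂ)⁻¹ * numberOp d f z := by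
  funext z
  rw [shiftFactor, div_eq_inv_mul]

lemma HolomorphicOnBall.shiftProd {d : ℕ} (s : ℝ) (m : ℕ) {f : Cd d → ℂ}
    (hf : HolomorphicOnBall d f) : HolomorphicOnBall d (shiftProd d s m f) := by
  induction m generalizing f with
  | zero => exact hf
  | succ m ih =>
    refine ih ?_
    rw [shiftFactor_eq]
    exact hf.add_const_mul hf.numberOp _

lemma homogComp_shiftProd {d : ℕ} (s : ℝ) (m : ℕ) {f : Cd d → ℂ} (hf : HolomorphicOnBall d f)
    (k : ℕ) (z : Cd d) :
    homogComp k (shiftProd d s m f) z = (shiftEigenvalue s m k : ℂ) * homogComp k f z := by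
  induction m generalizing f with
  | zero => simp [shiftProd, shiftEigenvalue]
  | succ m ih =>
    have h := hf.add_const_mul hf.numberOp ((s + m : ℝ) : ℂ)⁻¹
    rw [shiftProd, Function.comp_apply, shiftFactor_eq, ih h,
      homogComp_add_const_mul hf hf.numberOp, homogComp_numberOp hf, shiftEigenvalue_succ]
    push_cast
    ring

lemma HolomorphicOnBall.numberOp_iterate {d : ℕ} (l : ℕ) {f : Cd d → ℂ}
    (hf : HolomorphicOnBall d f) : HolomorphicOnBall d ((Bergman.numberOp d)^[l] f) := by
  induction l generalizing f with
  | zero => exact hf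
  | succ l ih => exact ih hf.numberOp

lemma homogComp_numberOp_iterate {d : ℕ} (l : ℕ) {f : Cd d → ℂ} (hf : HolomorphicOnBall d f)
    (k : ℕ) (z : Cd d) : homogComp k ((numberOp d)^[l] f) z = (k : ℂ) ^ l * homogComp k f z := by
  induction l generalizing f with
  | zero => simp
  | succ l ih =>
    rw [Function.iterate_succ_apply, ih hf.numberOp, homogComp_numberOp hf]
    ring

/-! ### Transfer of membership between weights. -/

lemma lintegral_homogComp_add {d : ℕ} {lam : ℝ} (h : (d : ℝ) < lam) {f : Cd d → ℂ}
    (hf : HolomorphicOnBall d f) (k m : ℕ) :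
    ∫⁻ z, ‖homogComp k f z‖ₑ ^ 2 ∂(mu d lam) = ENNReal.ofReal (shiftEigenvalue lam m k) *
      ∫⁻ z, ‖homogComp k f z‖ₑ ^ 2 ∂(mu d (lam + m)) :=
  lintegral_mu_add h (measurable_homogComp hf k) (homogComp_smul k f) m

/-- A holomorphic function whose components are controlled by those of an element of
`HL²(B^d, μ_λ)` belongs to `HL²(B^d, μ_{λ+m})`. -/
lemma MemHL2.of_homogComp_le {d : ℕ} {lam : ℝ} (hlam : (d : ℝ) < lam) {m : ℕ} {f h : Cd d → ℂ}
    (hf : MemHL2 d lam f) (hh : HolomorphicOnBall d h) {C : ℝ} {e : ℕ → ℝ}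
    (hC : ∀ k, e k ^ 2 ≤ C * shiftEigenvalue lam m k)
    (he : ∀ k z, homogComp k h z = (e k : ℂ) * homogComp k f z) : MemHL2 d (lam + m) h := by
  have h0 : (0 : ℝ) < lam := (Nat.cast_nonneg d).trans_lt hlam
  rw [memHL2_iff hh, lintegral_enorm_sq_eq_tsum _ hh]
  have hfin := (memHL2_iff hf.1).1 hf
  rw [lintegral_enorm_sq_eq_tsum _ hf.1] at hfin
  refine lt_of_le_of_lt ?_ (ENNReal.mul_lt_top (ENNReal.ofReal_lt_top (r := C)) hfin)
  rw [← ENNReal.tsum_mul_left]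
  refine ENNReal.tsum_le_tsum fun k => ?_
  have hm := (measurable_homogComp hf.1 k).enorm.pow_const 2
  rw [lintegral_homogComp_add hlam hf.1 k m, ← mul_assoc,
    ← ENNReal.ofReal_mul' (shiftEigenvalue_pos h0 m k).le, ← lintegral_const_mul _ hm]
  refine lintegral_mono fun z => ?_
  rw [he, enorm_mul, mul_pow, enorm_sq_eq_ofReal (e k : ℂ), Complex.norm_real, Real.norm_eq_abs,
    sq_abs]
  gcongr
  exact hC k

/-- The norm ratio in degree `k` is at most a constant times `1 + k^(2n)`, so the extreme iterates
`l = 0` and `l = n` already suffice. -/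
lemma MemHL2.of_numberOp_iterate {d : ℕ} {lam : ℝ} (hlam : (d : ℝ) < lam) {n : ℕ} {f : Cd d → ℂ}
    (h0 : MemHL2 d (lam + (2 * n : ℕ)) f)
    (hn : MemHL2 d (lam + (2 * n : ℕ)) ((numberOp d)^[n] f)) : MemHL2 d lam f := by
  have hpos : (0 : ℝ) < lam := (Nat.cast_nonneg d).trans_lt hlam
  have hf := h0.1
  have h1 := (memHL2_iff hf).1 h0
  have h2 := (memHL2_iff hn.1).1 hn
  rw [lintegral_enorm_sq_eq_tsum _ hf] at h1
  rw [lintegral_enorm_sq_eq_tsum _ hn.1] at h2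
  rw [memHL2_iff hf, lintegral_enorm_sq_eq_tsum _ hf]
  -- The first factor comes from `shiftEigenvalue_le`, the second from `(1 + k)^p ≤ 2^(p-1) (1 +
  -- k^p)` with `p = 2n`; for `n = 0` the truncated exponent is harmless.
  set C : ℝ := (1 + 1 / lam) ^ (2 * n) * 2 ^ (2 * n - 1)
  refine lt_of_le_of_lt ?_ (ENNReal.mul_lt_top (ENNReal.ofReal_lt_top (r := C))
    (ENNReal.add_lt_top.2 ⟨h1, h2⟩))
  rw [← ENNReal.tsum_add, ← ENNReal.tsum_mul_left]
  refine ENNReal.tsum_le_tsum fun k => ?_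
  have hm := (measurable_homogComp hf k).enorm.pow_const 2
  have hk : ∀ z, ‖homogComp k ((numberOp d)^[n] f) z‖ₑ ^ 2 =
      ENNReal.ofReal ((k : ℝ) ^ (2 * n)) * ‖homogComp k f z‖ₑ ^ 2 := fun z => by
    rw [homogComp_numberOp_iterate n hf, enorm_mul, mul_pow, enorm_sq_eq_ofReal ((k : ℂ) ^ n),
      norm_pow, Complex.norm_natCast, ← pow_mul, mul_comm n 2]
  simp_rw [hk]
  rw [lintegral_const_mul _ hm, lintegral_homogComp_add hlam hf k (2 * n), ← one_add_mul,
    ← mul_assoc, ← ENNReal.ofReal_one, ← ENNReal.ofReal_add zero_le_one (by positivity),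
    ← ENNReal.ofReal_mul (by positivity)]
  gcongr
  refine (shiftEigenvalue_le hpos _ k).trans ?_
  rw [mul_pow, mul_assoc]
  gcongr
  simpa using add_pow_le (zero_le_one' ℝ) (Nat.cast_nonneg k) (2 * n)

/-! ### Inner products by polarization. -/

lemma integral_norm_sq_eq_toReal {d : ℕ} {ν : Measure (Cd d)} {u : Cd d → ℂ}
    (hu : AEStronglyMeasurable u ν) :
    ∫ z, ‖u z‖ ^ 2 ∂ν = (∫⁻ z, ‖u z‖ₑ ^ 2 ∂ν).toReal := by
  rw [integral_eq_lintegral_of_nonneg_ae (f := fun z => ‖u z‖ ^ 2)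
    (Eventually.of_forall fun z => by positivity) (hu.norm.pow 2)]
  simp_rw [enorm_sq_eq_ofReal]

/-- Polarization reduces inner products to squared norms of `f + c g`, whose components are `f_k + c
g_k`; the norm identities then apply unchanged. -/
lemma integral_conj_mul_eq {d : ℕ} {ν : Measure (Cd d)} {f g : Cd d → ℂ} (hf : MemLp f 2 ν)
    (hg : MemLp g 2 ν) :
    ∫ z, starRingEnd ℂ (f z) * g z ∂ν =
      (((∫ z, ‖f z + 1 * g z‖ ^ 2 ∂ν : ℝ) : ℂ) - (∫ z, ‖f z + (-1) * g z‖ ^ 2 ∂ν : ℝ) +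
        ((∫ z, ‖f z + (-Complex.I) * g z‖ ^ 2 ∂ν : ℝ) -
          (∫ z, ‖f z + Complex.I * g z‖ ^ 2 ∂ν : ℝ)) * Complex.I) / 4 := by
  have hi : ∀ c : ℂ, Integrable (fun z => ((‖f z + c * g z‖ ^ 2 : ℝ) : ℂ)) ν := fun c =>
    ((memLp_two_iff_integrable_sq_norm (hf.add (hg.const_mul c)).1).1
      (hf.add (hg.const_mul c))).ofReal
  have hs : ∀ c c' : ℂ, Integrable (fun z => ((‖f z + c * g z‖ ^ 2 : ℝ) : ℂ) -
      ((‖f z + c' * g z‖ ^ 2 : ℝ) : ℂ)) ν := fun c c' => (hi c).sub (hi c')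
  simp_rw [← integral_complex_ofReal]
  rw [← integral_sub (hi _) (hi _), ← integral_sub (hi _) (hi _), ← integral_mul_const,
    ← integral_add (hs _ _) ((hs _ _).mul_const _), ← integral_div]
  refine integral_congr_ae (Eventually.of_forall fun z => ?_)
  have h := inner_eq_sum_norm_sq_div_four (𝕜 := ℂ) (f z) (g z)
  rw [RCLike.inner_apply'] at h
  refine h.trans ?_
  simp [sub_eq_add_neg]

lemma MemHL2.homogComp {d : ℕ} {lam : ℝ} {f : Cd d → ℂ} (hf : MemHL2 d lam f) (k : ℕ) :
    MemLp (homogComp k f) 2 (mu d lam) := by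
  rw [memLp_two_iff (measurable_homogComp hf.1 k).aestronglyMeasurable]
  have h := (memHL2_iff hf.1).1 hf
  rw [lintegral_enorm_sq_eq_tsum _ hf.1] at h
  exact (ENNReal.le_tsum k).trans_lt h

lemma MemHL2.homogComp_add {d : ℕ} {lam : ℝ} (hlam : (d : ℝ) < lam) {f : Cd d → ℂ}
    (hf : MemHL2 d lam f) (k m : ℕ) : MemLp (Bergman.homogComp k f) 2 (mu d (lam + m)) := by
  have hpos : (0 : ℝ) < lam := (Nat.cast_nonneg d).trans_lt hlam
  have hm := (measurable_homogComp hf.1 k)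
  have h := (memLp_two_iff hm.aestronglyMeasurable).1 (hf.homogComp k)
  rw [lintegral_homogComp_add hlam hf.1 k m] at h
  rw [memLp_two_iff hm.aestronglyMeasurable]
  exact ENNReal.lt_top_of_mul_ne_top_right h.ne
    (ENNReal.ofReal_pos.2 (shiftEigenvalue_pos hpos m k)).ne'

lemma MemHL2.add_const_mul {d : ℕ} {lam : ℝ} {f g : Cd d → ℂ} (hf : MemHL2 d lam f)
    (hg : MemHL2 d lam g) (c : ℂ) : MemHL2 d lam fun z => f z + c * g z :=
  ⟨hf.1.add_const_mul hg.1 c, hf.2.add (hg.2.const_mul c)⟩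

lemma MemHL2.hasSum_integral_norm_sq {d : ℕ} {lam : ℝ} {f : Cd d → ℂ} (hf : MemHL2 d lam f) :
    HasSum (fun k => ∫ z, ‖Bergman.homogComp k f z‖ ^ 2 ∂(mu d lam))
      (∫ z, ‖f z‖ ^ 2 ∂(mu d lam)) := by
  have h := (memHL2_iff hf.1).1 hf
  simp_rw [integral_norm_sq_eq_toReal (hf.1.aestronglyMeasurable lam),
    fun k => integral_norm_sq_eq_toReal
      (measurable_homogComp hf.1 k).aestronglyMeasurable (ν := mu d lam)]
  rw [lintegral_enorm_sq_eq_tsum _ hf.1] at h ⊢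
  rw [ENNReal.tsum_toReal_eq fun k => ((ENNReal.le_tsum k).trans_lt h).ne]
  exact ENNReal.hasSum_toReal h.ne

/-- Parseval's identity for the inner product. -/
lemma hasSum_innerHL2 {d : ℕ} {lam : ℝ} {f g : Cd d → ℂ} (hf : MemHL2 d lam f)
    (hg : MemHL2 d lam g) :
    HasSum (fun k => innerHL2 d lam (homogComp k f) (homogComp k g)) (innerHL2 d lam f g) := by
  have hs : ∀ c : ℂ, HasSum
      (fun k => ((∫ z, ‖homogComp k f z + c * homogComp k g z‖ ^ 2 ∂(mu d lam) : ℝ) : ℂ))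
      ((∫ z, ‖f z + c * g z‖ ^ 2 ∂(mu d lam) : ℝ) : ℂ) := fun c => by
    have := (hf.add_const_mul hg c).hasSum_integral_norm_sq
    simp_rw [homogComp_add_const_mul hf.1 hg.1 c] at this
    exact Complex.hasSum_ofReal.2 this
  simp only [innerHL2]
  simp_rw [fun k => integral_conj_mul_eq (hf.homogComp k) (hg.homogComp k)]
  rw [integral_conj_mul_eq hf.2 hg.2]
  exact (((hs 1).sub (hs (-1))).add (((hs (-Complex.I)).sub (hs Complex.I)).mul_right
    Complex.I)).div_const 4

lemma innerHL2_homogComp_add {d : ℕ} {lam : ℝ} (hlam : (d : ℝ) < lam) {f g : Cd d → ℂ}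
    (hf : MemHL2 d lam f) (hg : MemHL2 d lam g) (k m : ℕ) :
    innerHL2 d lam (homogComp k f) (homogComp k g) = (shiftEigenvalue lam m k : ℂ) *
      innerHL2 d (lam + m) (homogComp k f) (homogComp k g) := by
  have hpos : (0 : ℝ) < lam := (Nat.cast_nonneg d).trans_lt hlam
  have hq : ∀ c : ℂ, ∫ z, ‖homogComp k f z + c * homogComp k g z‖ ^ 2 ∂(mu d lam) =
      shiftEigenvalue lam m k *
        ∫ z, ‖homogComp k f z + c * homogComp k g z‖ ^ 2 ∂(mu d (lam + m)) := fun c => by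
    have hm := measurable_homogComp (hf.1.add_const_mul hg.1 c) k
    have h := lintegral_homogComp_add hlam (hf.1.add_const_mul hg.1 c) k m
    simp_rw [← homogComp_add_const_mul hf.1 hg.1 c]
    rw [integral_norm_sq_eq_toReal hm.aestronglyMeasurable,
      integral_norm_sq_eq_toReal hm.aestronglyMeasurable, h, ENNReal.toReal_mul,
      ENNReal.toReal_ofReal (shiftEigenvalue_pos hpos m k).le]
  rw [innerHL2, innerHL2, integral_conj_mul_eq (hf.homogComp k) (hg.homogComp k),
    integral_conj_mul_eq (hf.homogComp_add hlam k m) (hg.homogComp_add hlam k m)]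
  simp_rw [hq]
  push_cast
  ring

lemma innerHL2_const_mul (d : ℕ) (lam : ℝ) (a b : ℝ) (f g : Cd d → ℂ) :
    innerHL2 d lam (fun z => (a : ℂ) * f z) (fun z => (b : ℂ) * g z) =
      (a : ℂ) * b * innerHL2 d lam f g := by
  rw [innerHL2, innerHL2, ← integral_const_mul]
  refine integral_congr_ae (Eventually.of_forall fun z => ?_)
  simp only [map_mul, Complex.conj_ofReal]
  ring

/-- Supplies the growth hypothesis of `MemHL2.of_homogComp_le`: multipliers of order `(1 + k)^n` are
affordable when the weight rises by `2n`. -/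
lemma exists_pow_le_shiftEigenvalue {s : ℝ} (hs : 0 < s) (n : ℕ) (c : ℝ) (hc : 0 ≤ c) :
    ∃ C : ℝ, ∀ k : ℕ, ((c * (1 + k)) ^ n) ^ 2 ≤ C * shiftEigenvalue s (2 * n) k := by
  refine ⟨(c * (1 + s + (2 * n : ℕ))) ^ (2 * n), fun k => ?_⟩
  have h := le_shiftEigenvalue hs (2 * n) k
  calc ((c * (1 + k)) ^ n) ^ 2
      = (c * (1 + s + (2 * n : ℕ))) ^ (2 * n) * ((1 + k) / (1 + s + (2 * n : ℕ))) ^ (2 * n) := by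
        rw [← mul_pow, ← pow_mul, mul_comm n 2]
        congr 1
        field_simp
    _ ≤ _ := by gcongr

end Bergman


theorem mainTheorem7 (d : ℕ) (lam : ℝ) (hlam : (d : ℝ) < lam) (n : ℕ) :
    (∀ f : Bergman.Cd d → ℂ, Bergman.HolomorphicOnBall d f →
      (Bergman.MemHL2 d lam f ↔
        ∀ l : ℕ, l ≤ n → Bergman.MemHL2 d (lam + 2 * n) ((Bergman.numberOp d)^[l] f))) ∧
    (∀ f g : Bergman.Cd d → ℂ, Bergman.MemHL2 d lam f → Bergman.MemHL2 d lam g →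
      Bergman.MemHL2 d (lam + 2 * n) (Bergman.opA d lam n f) ∧
      Bergman.MemHL2 d (lam + 2 * n) (Bergman.opB d lam n g) ∧
      Bergman.innerHL2 d lam f g =
        Bergman.innerHL2 d (lam + 2 * n) (Bergman.opA d lam n f) (Bergman.opB d lam n g)) := by
  have hpos : (0 : ℝ) < lam := (Nat.cast_nonneg d).trans_lt hlam
  have h2n : lam + 2 * (n : ℝ) = lam + (2 * n : ℕ) := by push_cast; rfl
  rw [h2n]
  have hshift : ∀ (s : ℝ), 0 < s → ∀ f, Bergman.MemHL2 d lam f →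
      Bergman.MemHL2 d (lam + (2 * n : ℕ)) (Bergman.shiftProd d s n f) := by
    intro s hs f hf
    obtain ⟨C, hC⟩ := Bergman.exists_pow_le_shiftEigenvalue hpos n (1 + 1 / s) (by positivity)
    refine hf.of_homogComp_le hlam (hf.1.shiftProd s n) (fun k => le_trans ?_ (hC k))
      (Bergman.homogComp_shiftProd s n hf.1)
    have := (Bergman.shiftEigenvalue_pos hs n k).le
    gcongr
    exact Bergman.shiftEigenvalue_le hs n k
  refine ⟨fun f hf => ⟨fun hmem l hl => ?_, fun h => ?_⟩, fun f g hf hg => ?_⟩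
  · obtain ⟨C, hC⟩ := Bergman.exists_pow_le_shiftEigenvalue hpos n 1 zero_le_one
    refine hmem.of_homogComp_le hlam (hf.numberOp_iterate l) (e := fun k => (k : ℝ) ^ l)
      (fun k => le_trans ?_ (hC k)) fun k z => ?_
    · have : (k : ℝ) ^ l ≤ (1 + k) ^ n :=
        (pow_le_pow_left₀ (by positivity) (by linarith) l).trans
          (pow_le_pow_right₀ (by linarith [Nat.cast_nonneg (α := ℝ) k]) hl)
      rw [one_mul]
      gcongr
    · rw [Bergman.homogComp_numberOp_iterate l hf]
      push_cast
      rfl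
  · exact Bergman.MemHL2.of_numberOp_iterate hlam (h 0 n.zero_le) (h n le_rfl)
  · have hA := hshift (lam + n) (by positivity) f hf
    have hB := hshift lam hpos g hg
    -- Both inner products are sums over degrees, so it suffices to match terms: the weight change
    -- gives the eigenvalue with `2n` factors, which is the product of those of `B` and `A`.
    refine ⟨hA, hB, (Bergman.hasSum_innerHL2 hf hg).unique
      ((Bergman.hasSum_innerHL2 hA hB).congr_fun fun k => ?_)⟩
    rw [Bergman.innerHL2_homogComp_add hlam hf hg k (2 * n),
      funext (Bergman.homogComp_shiftProd (lam + n) n hf.1 k),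
      funext (Bergman.homogComp_shiftProd lam n hg.1 k), Bergman.innerHL2_const_mul, two_mul,
      Bergman.shiftEigenvalue_add]
    push_cast
    ring
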